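/- Let $n\ge 0$. A parking function $PF$ on $n$ cars is a Dyck path in the $n\times n$ square (north and east steps from the southwest to the northeast corner, staying weakly above the diagonal) whose north steps are labeled bijectively by the cars $1,\dots,n$, increasing up each column. Numbering the rows from bottom to top, it is encoded by integers $u_1,\dots,u_n$ and a permutation $(v_1,\dots,v_n)$ of $\{1,\dots,n\}$ with $u_1=0$, $0\le u_i\le u_{i-1}+1$, and $v_{i-1}<v_i$ whenever $u_i=u_{i-1}+1$; here $u_i$ is the number of full cells in row $i$ between the path and the main diagonal, and $v_i$ is the car in row $i$. A car $v_i$ is in the main diagonal if $u_i=0$. The reading word of $PF$ lists the cars $v_i$ by decreasing value of $u_i$ and, among equal values of $u_i$, by decreasing index $i$. Put $$\operatorname{area}(PF)=\sum_{i=1}^n u_i,\qquad \operatorname{coarea}(PF)=\binom n2-\operatorname{area}(PF),$$ $$\operatorname{dinv}(PF)=\#\{i<j: u_i=u_j,\ v_i<v_j\}+\#\{i<j: u_i=u_j+1,\ v_i>v_j\}.$$ Let $q$ be an indeterminate, $[m]_q=1+q+\dots+q^{m-1}$, $[m]_q!=[1]_q[2]_q\cdots[m]_q$, and $\left[{m\atop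 k}\right]_q=\frac{[m]_q!}{[k]_q!\,[m-k]_q!}$ for $0\le k\le m$. For integers $a,b\ge 0$ with $a+b=n$, call $1,\dots,a$ the small cars and $a+1,\dots,a+b$ the big cars, and let $\mathcal{PF}_{a,b}^{(r,s)}$ be the set of parking functions on $n$ cars whose reading word is a shuffle of the words $1\,2\cdots a$ and $(a+1)\,(a+2)\cdots(a+b)$ and which have exactly $r$ small cars and exactly $s$ big cars in the main diagonal. **Theorem.** For all $0\le s<b$ and $0\le r\le a$, $$\sum_{PF\in\mathcal{PF}_{a,b}^{(r,s)}} q^{\operatorname{coarea}(PF)+\operatorname{dinv}(PF)} = q^{\binom{a+b}{2}-(a-r+1)(b-s)}\left[{a+b-s-1\atop a}\right]_q\left[{a-r+b-s\atop a-r}\right]_q\left[{r+s\atop s}\right]_q\frac{[r]_q}{[a-r+b-s]_q},$$ and for all $b\ge 0$ and $0\le r\le a$, $$\sum_{PF\in\mathcal{PF}_{a,b}^{(r,b)}} q^{\operatorname{coarea}(PF)+\operatorname{dinv}(PF)} = \chi(a=r)\,q^{\binom{a+b}{2}}\left[{a+b\atop a}\right]_q,$$ where $\chi(a=r)$ is $1$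 if $a=r$ and $0$ otherwise. -/

import Mathlib

/-- The `q`-integer `[n]_q = 1 + q + ⋯ + q^(n-1)`. -/
def qInt {K : Type*} [Field K] (q : K) (n : ℕ) : K :=
  ∑ i ∈ Finset.range n, q ^ i

/-- The `q`-factorial `[n]_q! = [1]_q [2]_q ⋯ [n]_q`. -/
def qFactorial {K : Type*} [Field K] (q : K) (n : ℕ) : K :=
  ∏ i ∈ Finset.range n, qInt q (i + 1)

/-- The `q`-binomial coefficient `[n]_q! / ([k]_q! [n-k]_q!)` for `k ≤ n`, and `0` for `k > n`. It is
only used where `q` is an indeterminate, so that no `q`-factorial vanishes. -/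
noncomputable def qBinomial {K : Type*} [Field K] (q : K) (n k : ℕ) : K :=
  if k ≤ n then qFactorial q n / (qFactorial q k * qFactorial q (n - k)) else 0

/-- A parking function in the `n × n` lattice square (a Dyck path whose north steps are labeled
by `1, …, n`, increasing up each column), as a two-line array. The rows are indexed from bottom to
top by `Fin n`. The entry `u i` is the number of full cells of row `i` between the Dyck path and the
main diagonal, and `v i` encodes the car in row `i`; as `Fin n` starts at `0`, this car is
`v i + 1`. -/
@[ext]
structure ParkingFunction (n : ℕ) where
  u : Fin n → ℕ
  v : Equiv.Perm (Fin n)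
  u_first : ∀ i : Fin n, (i : ℕ) = 0 → u i = 0
  u_step : ∀ i j : Fin n, (j : ℕ) = (i : ℕ) + 1 → u j ≤ u i + 1
  v_column : ∀ i j : Fin n, (j : ℕ) = (i : ℕ) + 1 → u j = u i + 1 → v i < v j

namespace ParkingFunction

theorem u_le {n : ℕ} (P : ParkingFunction n) (i : Fin n) : P.u i ≤ (i : ℕ) := by
  obtain ⟨k, hk⟩ := i
  induction k with
  | zero => exact (P.u_first ⟨0, hk⟩ rfl).le
  | succ k ih =>
    have h1 := ih (by omega)
    have h2 := P.u_step ⟨k, by omega⟩ ⟨k + 1, hk⟩ rfl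
    simp only at h1 ⊢
    omega

instance instFinite (n : ℕ) : Finite (ParkingFunction n) := by
  let f : ParkingFunction n → (Fin n → Fin n) × Equiv.Perm (Fin n) := fun P =>
    (fun i => ⟨P.u i, (P.u_le i).trans_lt i.isLt⟩, P.v)
  refine Finite.of_injective f fun P Q h => ?_
  have h1 := congrArg Prod.fst h
  have h2 := congrArg Prod.snd h
  refine ParkingFunction.ext (funext fun i => ?_) h2
  exact congrArg Fin.val (congrFun h1 i)

noncomputable instance instFintype (n : ℕ) : Fintype (ParkingFunction n) :=
  Fintype.ofFinite _

/-- The car, an element of `{1, …, n}`, in row `i`. -/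
def car {n : ℕ} (P : ParkingFunction n) (i : Fin n) : ℕ :=
  (P.v i : ℕ) + 1

/-- The number of full cells between the Dyck path and the main diagonal. -/
def area {n : ℕ} (P : ParkingFunction n) : ℕ :=
  ∑ i, P.u i

/-- `coarea = (n choose 2) - area`, as an integer, so that the subtraction does not truncate. -/
def coarea {n : ℕ} (P : ParkingFunction n) : ℤ :=
  (n.choose 2 : ℤ) - (P.area : ℤ)

/-- The number of diagonal inversions: the primary ones plus the secondary ones. -/
def dinv {n : ℕ} (P : ParkingFunction n) : ℕ :=
  (Finset.univ.filter fun p : Fin n × Fin n =>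
      p.1 < p.2 ∧ P.u p.1 = P.u p.2 ∧ P.car p.1 < P.car p.2).card +
  (Finset.univ.filter fun p : Fin n × Fin n =>
      p.1 < p.2 ∧ P.u p.1 = P.u p.2 + 1 ∧ P.car p.2 < P.car p.1).card

/-- The reading word (diagonal word): the cars are read by decreasing values of `u`, and from right
to left (that is, by decreasing row index) among equal values of `u`. All values of `u` are less
than `n`. -/
def readingWord {n : ℕ} (P : ParkingFunction n) : List ℕ :=
  (List.range n).reverse.flatMap fun d =>
    ((List.finRange n).reverse.filter fun i => P.u i = d).map P.car

end ParkingFunction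

/-- `IsShuffle x y w`: the word `w` is obtained by interleaving the words `x` and `y`, each of
which keeps the order of its letters. -/
inductive IsShuffle {α : Type*} : List α → List α → List α → Prop
  | nil : IsShuffle [] [] []
  | left {x y w : List α} (c : α) : IsShuffle x y w → IsShuffle (c :: x) y (c :: w)
  | right {x y w : List α} (c : α) : IsShuffle x y w → IsShuffle x (c :: y) (c :: w)

/-- The parking functions on `a + b` cars whose reading word is a shuffle of `1 2 ⋯ a` and
`a+1 a+2 ⋯ a+b`, and which have exactly `r` small cars (at most `a`) and exactly `s` big cars
(greater than `a`) in the main diagonal. -/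
noncomputable def shufflePF (a b r s : ℕ) : Finset (ParkingFunction (a + b)) :=
  open Classical in
  Finset.univ.filter fun P =>
    IsShuffle (List.range' 1 a) (List.range' (a + 1) b) P.readingWord ∧
    (Finset.univ.filter fun i => P.u i = 0 ∧ P.car i ≤ a).card = r ∧
    (Finset.univ.filter fun i => P.u i = 0 ∧ a < P.car i).card = s

/-! Along the reading word the small cars increase, and so do the big ones, so the parking function
is determined by its letters: the diagonal and the kind of the car in each row. Cars of equal kind
never form a diagonal inversion, and a north step on top of another must put a big car on a small
one. The sum thus runs over chains of letters (`ParkingFunction.sum_shufflePF`).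

Such a chain is peeled diagonal by diagonal. Write h_i(s) for `qMultichoose q s i`. Delete the main
diagonal, with word `w` containing r small letters, and lower the rest to a chain `M`. Each of the c
big cars in the lowest diagonal of `M` either follows the previous car above the main diagonal
directly or sits on a small main-diagonal car; every other car of `M` has a forced place. The
inversions across the two diagonals therefore contribute h_c(r) (`sum_lifts`), while lowering costs
q^(-|M|). Moreover `M` is empty or starts with a big car, so its own main diagonal, with i small and
c big cars, contributes h_i(c) (`sum_bigWords`).

This gives a recursion for the generating function of the part above a main diagonal with r small
cars. The closed form `upperSum` solves it by two applications of q-Vandermonde, each prepared by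
the absorption rule `qMultichoose_succ_mul_qInt` (`sum_upperSum`). Summing over the main-diagonal
words contributes the remaining factor h_r(s+1). -/

section QAlgebra

/-! ### Complete homogeneous polynomials in powers of q, and the recursion solved by `upperSum` -/

variable {K : Type*} [Field K] (q : K)

theorem qInt_zero : qInt q 0 = 0 := by simp [qInt]

theorem qInt_add (m n : ℕ) : qInt q (m + n) = qInt q m + q ^ m * qInt q n := by
  simp [qInt, Finset.sum_range_add, pow_add, Finset.mul_sum]

theorem qFactorial_succ (n : ℕ) : qFactorial q (n + 1) = qFactorial q n * qInt q (n + 1) := by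
  simp [qFactorial, Finset.prod_range_succ]

theorem qFactorial_ne_zero {q : K} (hq : ∀ n, qInt q (n + 1) ≠ 0) (n : ℕ) :
    qFactorial q n ≠ 0 :=
  Finset.prod_ne_zero_iff.2 fun i _ => hq i

/-- The complete homogeneous symmetric polynomial of degree `i` in `1, q, …, q ^ (s - 1)`. -/
def qMultichoose : ℕ → ℕ → K
  | 0, 0 => 1
  | 0, _ + 1 => 0
  | _ + 1, 0 => 1
  | s + 1, i + 1 => qMultichoose s (i + 1) + q ^ s * qMultichoose (s + 1) i

@[simp] theorem qMultichoose_zero_right (s : ℕ) : qMultichoose q s 0 = 1 := by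
  cases s <;> simp [qMultichoose]

@[simp] theorem qMultichoose_zero_succ (i : ℕ) : qMultichoose q 0 (i + 1) = 0 := by
  simp [qMultichoose]

theorem qMultichoose_succ_succ (s i : ℕ) : qMultichoose q (s + 1) (i + 1) =
    qMultichoose q s (i + 1) + q ^ s * qMultichoose q (s + 1) i := by
  simp [qMultichoose]

/-- Kept free of division so that it holds for every q. The double induction rests on [s+1+i+1] =
[s+1] + q^(s+1) [i+1]. -/
theorem qMultichoose_mul_qFactorial (s i : ℕ) :
    qMultichoose q (s + 1) i * (qFactorial q s * qFactorial q i) = qFactorial q (s + i) := by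
  induction s generalizing i with
  | zero =>
    induction i with
    | zero => simp [qFactorial]
    | succ i ih =>
      have h : qMultichoose q (0 + 1) (i + 1) = qMultichoose q (0 + 1) i := by
        simp [qMultichoose_succ_succ q 0 i]
      rw [h, ← add_assoc, qFactorial_succ, qFactorial_succ, ← ih]
      simp only [zero_add]
      ring
  | succ s ihs =>
    induction i with
    | zero => simp [qFactorial]
    | succ i ih =>
      rw [qMultichoose_succ_succ]
      have h1 := ihs (i + 1)
      have h2 : qFactorial q (s + 1 + (i + 1)) =
          qFactorial q (s + 1 + i) * (qInt q (s + 1) + q ^ (s + 1) * qInt q (i + 1)) := by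
        rw [← qInt_add, ← add_assoc, qFactorial_succ]
      have h3 : qFactorial q (s + (i + 1)) = qFactorial q (s + 1 + i) := by
        rw [add_right_comm, add_assoc]
      rw [h3] at h1
      rw [h2, mul_add]
      nth_rewrite 1 [← h1]
      rw [← ih]
      simp only [qFactorial_succ]
      ring

section Regular

variable {q}

theorem qMultichoose_succ_eq_div (hq : ∀ n, qInt q (n + 1) ≠ 0) (s i : ℕ) :
    qMultichoose q (s + 1) i = qFactorial q (s + i) / (qFactorial q s * qFactorial q i) := by
  rw [← qMultichoose_mul_qFactorial, mul_div_cancel_right₀]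
  exact mul_ne_zero (qFactorial_ne_zero hq _) (qFactorial_ne_zero hq _)

theorem qMultichoose_eq_qBinomial (hq : ∀ n, qInt q (n + 1) ≠ 0) (s i : ℕ) :
    qMultichoose q (s + 1) i = qBinomial q (s + i) s := by
  rw [qMultichoose_succ_eq_div hq, qBinomial, if_pos (Nat.le_add_right _ _), Nat.add_sub_cancel_left]

theorem qBinomial_symm_add (s i : ℕ) : qBinomial q (s + i) s = qBinomial q (s + i) i := by
  rw [qBinomial, qBinomial, if_pos (Nat.le_add_right _ _), if_pos (Nat.le_add_left _ _),
    Nat.add_sub_cancel_left, Nat.add_sub_cancel, mul_comm (qFactorial q s)]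

/-- Absorption rule: it trades a factor depending on the summation index for the constant [s], which
makes q-Vandermonde applicable. -/
theorem qMultichoose_succ_mul_qInt (hq : ∀ n, qInt q (n + 1) ≠ 0) (s r : ℕ) :
    qMultichoose q s (r + 1) * qInt q (r + 1) = qInt q s * qMultichoose q (s + 1) r := by
  cases s with
  | zero => simp [qInt_zero]
  | succ s =>
    rw [qMultichoose_succ_eq_div hq, qMultichoose_succ_eq_div hq, qFactorial_succ q r,
      qFactorial_succ q s, show s + (r + 1) = s + 1 + r by ring]
    have h1 := hq s
    have h2 := hq r
    have h3 := qFactorial_ne_zero hq s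
    have h4 := qFactorial_ne_zero hq r
    field_simp

end Regular

/-- The `q`-Vandermonde convolution for complete homogeneous symmetric polynomials. -/
theorem sum_antidiagonal_qMultichoose (s m N : ℕ) :
    ∑ x ∈ Finset.HasAntidiagonal.antidiagonal N,
      q ^ (m * x.1) * qMultichoose q s x.1 * qMultichoose q m x.2 = qMultichoose q (s + m) N := by
  induction s generalizing N with
  | zero =>
    rw [Finset.sum_eq_single (0, N)]
    · simp
    · rintro ⟨i, j⟩ hx hne
      cases i with
      | zero => simp_all
      | succ i => simp
    · simp
  | succ s ihs =>
    induction N with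
    | zero => simp
    | succ N ih =>
      have key := ihs (N + 1)
      rw [Finset.Nat.sum_antidiagonal_succ] at key ⊢
      simp only [mul_zero, pow_zero, one_mul,
        qMultichoose_zero_right] at key ⊢
      -- Under the Pascal rule, the terms avoiding the last variable q^s form the sum for s at N+1;
      -- the others form q^(s+m) times the sum for s+1 at N.
      rw [show s + 1 + m = s + m + 1 by ring, qMultichoose_succ_succ, ← key,
        show s + m + 1 = s + 1 + m by ring, ← ih, Finset.mul_sum, add_assoc,
        ← Finset.sum_add_distrib]
      congr 1
      refine Finset.sum_congr rfl fun x _ => ?_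
      rw [qMultichoose_succ_succ]
      ring

theorem sum_antidiagonal_inv_pow_qMultichoose {q : K} (h0 : q ≠ 0) (s m N : ℕ) :
    ∑ x ∈ Finset.HasAntidiagonal.antidiagonal N,
      qMultichoose q s x.1 * (qMultichoose q m x.2 * (q ^ (m * x.2))⁻¹) =
        (q ^ (m * N))⁻¹ * qMultichoose q (s + m) N := by
  rw [← sum_antidiagonal_qMultichoose, Finset.mul_sum]
  refine Finset.sum_congr rfl fun x hx => ?_
  rw [← Finset.HasAntidiagonal.mem_antidiagonal.1 hx, mul_add, pow_add]
  have h1 := pow_ne_zero (m * x.1) h0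
  have h2 := pow_ne_zero (m * x.2) h0
  field_simp

/-- The generating function of the part above the main diagonal, consisting of `A` small and `B` big
cars, over a main diagonal with `r` small cars. -/
def upperSum (r A B : ℕ) : K :=
  if B = 0 then (if A = 0 then 1 else 0)
  else (q ^ ((A + 1) * B))⁻¹ * qMultichoose q (r + A + 1) (B - 1) * qMultichoose q B A *
    qInt q r / qInt q B

theorem upperSum_zero_zero (r : ℕ) : upperSum q r 0 0 = 1 := by simp [upperSum]

theorem upperSum_succ_zero (r A : ℕ) : upperSum q r (A + 1) 0 = 0 := by simp [upperSum]

theorem upperSum_succ (r A B : ℕ) : upperSum q r A (B + 1) =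
    (q ^ ((A + 1) * (B + 1)))⁻¹ * qMultichoose q (r + A + 1) B * qMultichoose q (B + 1) A *
      qInt q r / qInt q (B + 1) := by
  simp [upperSum]

/-- The analytic counterpart of `listsOver_nil`; both sides of the recursion vanish when the main
diagonal is empty. -/
theorem upperSum_zero_left {A B : ℕ} (h : 0 < A + B) : upperSum q 0 A B = 0 := by
  rcases B with _ | B
  · obtain ⟨A, rfl⟩ : ∃ k, A = k + 1 := ⟨A - 1, by omega⟩
    exact upperSum_succ_zero q 0 A
  · simp [upperSum_succ, qInt_zero]

variable {q}

theorem sum_upperSum_zero_right (s A : ℕ) :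
    ∑ y ∈ Finset.HasAntidiagonal.antidiagonal A, qMultichoose q s y.1 * upperSum q y.1 y.2 0 =
      qMultichoose q s A := by
  rw [Finset.sum_eq_single (A, 0)]
  · simp [upperSum_zero_zero]
  · rintro ⟨i, j⟩ hx hne
    cases j with
    | zero => simp_all
    | succ j => simp [upperSum_succ_zero]
  · simp

/-- Since the two indices sum to A+1, the middle factor of `upperSum` does not depend on them.
Absorption turns the rest into a q-Vandermonde sum. -/
theorem sum_upperSum_succ (h0 : q ≠ 0) (hq : ∀ n, qInt q (n + 1) ≠ 0) (s A m : ℕ) :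
    ∑ y ∈ Finset.HasAntidiagonal.antidiagonal (A + 1), qMultichoose q s y.1 * upperSum q y.1 y.2 (m + 1) =
      qMultichoose q (s + m + 2) A / qInt q (A + 1) * (qInt q s *
        (qMultichoose q (A + 1) (m + 1) * (q ^ ((A + 1) * (m + 1)))⁻¹)) := by
  rw [Finset.Nat.sum_antidiagonal_succ, upperSum_zero_left _ (by simp),
    mul_zero, zero_add]
  have hV := sum_antidiagonal_inv_pow_qMultichoose h0 (s + 1) (m + 1) A
  have h2 := qMultichoose_succ_mul_qInt hq (A + 1) m
  calc _ = ∑ x ∈ Finset.HasAntidiagonal.antidiagonal A, qMultichoose q (s + 1) x.1 *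
        (qMultichoose q (m + 1) x.2 * (q ^ ((m + 1) * x.2))⁻¹) *
        (qInt q s * (q ^ (m + 1))⁻¹ * qMultichoose q (A + 1 + 1) m / qInt q (m + 1)) := by
        refine Finset.sum_congr rfl fun x hx => ?_
        have hx' : x.1 + 1 + x.2 + 1 = A + 1 + 1 := by
          rw [← Finset.HasAntidiagonal.mem_antidiagonal.1 hx]; ring
        have h1 := qMultichoose_succ_mul_qInt hq s x.1
        rw [upperSum_succ, hx', show (x.2 + 1) * (m + 1) = (m + 1) * x.2 + (m + 1) by ring, pow_add, mul_inv]
        linear_combination ((q ^ ((m + 1) * x.2))⁻¹ * (q ^ (m + 1))⁻¹ *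
          qMultichoose q (A + 1 + 1) m * qMultichoose q (m + 1) x.2 / qInt q (m + 1)) * h1
    _ = _ := by
        rw [← Finset.sum_mul, hV, show (A + 1) * (m + 1) = (m + 1) * A + (m + 1) by ring,
          pow_add, mul_inv, show s + 1 + (m + 1) = s + m + 2 by ring]
        have e1 := hq m
        have e2 := hq A
        have e3 : qMultichoose q (A + 1 + 1) m / qInt q (m + 1) =
            qMultichoose q (A + 1) (m + 1) / qInt q (A + 1) := by
          rw [div_eq_div_iff e1 e2, h2, mul_comm]
        linear_combination ((q ^ ((m + 1) * A))⁻¹ * qMultichoose q (s + m + 2) A *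
          (qInt q s * (q ^ (m + 1))⁻¹)) * e3

/-- The recursion from peeling one diagonal: x.1 big and y.1 small cars form the next diagonal.
After the inner sum, the factor h_A(s+m+2) is constant because s+m = B, so absorption and
q-Vandermonde apply again. The cases A = 0 and B = 0 lie outside this pattern. -/
theorem sum_upperSum (h0 : q ≠ 0) (hq : ∀ n, qInt q (n + 1) ≠ 0) (r A B : ℕ) (hAB : 0 < A + B) :
    ∑ x ∈ Finset.HasAntidiagonal.antidiagonal B, ∑ y ∈ Finset.HasAntidiagonal.antidiagonal A,
      qMultichoose q r x.1 * (qMultichoose q x.1 y.1 * upperSum q y.1 y.2 x.2) =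
        q ^ (A + B) * upperSum q r A B := by
  simp only [← Finset.mul_sum]
  rcases B with _ | N
  · obtain ⟨A, rfl⟩ : ∃ k, A = k + 1 := ⟨A - 1, by omega⟩
    simp [sum_upperSum_zero_right, upperSum_succ_zero]
  rcases A with _ | A
  · rw [Finset.sum_eq_single (N + 1, 0)]
    · have h1 := qMultichoose_succ_mul_qInt hq r N
      have h2 := hq N
      have h3 := pow_ne_zero (N + 1) h0
      simp only [sum_upperSum_zero_right, upperSum_succ, qMultichoose_zero_right, zero_add, one_mul,
        mul_one, add_zero]
      field_simp
      linear_combination h1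
    · rintro ⟨s, m⟩ hx hne
      cases m with
      | zero => simp_all
      | succ m => simp [upperSum_zero_left]
    · simp
  have key : ∀ x ∈ Finset.HasAntidiagonal.antidiagonal (N + 1), qMultichoose q r x.1 *
      ∑ y ∈ Finset.HasAntidiagonal.antidiagonal (A + 1), qMultichoose q x.1 y.1 * upperSum q y.1 y.2 x.2 =
      qMultichoose q (N + 2) A / qInt q (A + 1) * (qMultichoose q r x.1 * qInt q x.1 *
        (qMultichoose q (A + 1) x.2 * (q ^ ((A + 1) * x.2))⁻¹)) := by
    rintro ⟨s, m⟩ hx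
    have hx' : s + m = N + 1 := Finset.HasAntidiagonal.mem_antidiagonal.1 hx
    cases m with
    | zero =>
      obtain rfl : s = N + 1 := by omega
      have h1 := qMultichoose_succ_mul_qInt hq (N + 1) A
      have h2 := hq A
      simp only [sum_upperSum_zero_right, qMultichoose_zero_right, mul_zero, pow_zero, inv_one,
        mul_one]
      field_simp
      linear_combination qMultichoose q r (N + 1) * h1
    | succ m =>
      simp only [sum_upperSum_succ h0 hq]
      rw [show s + m + 2 = N + 2 by omega]
      ring
  rw [Finset.sum_congr rfl key, ← Finset.mul_sum, Finset.Nat.sum_antidiagonal_succ]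
  simp only [qInt_zero, mul_zero, zero_mul, zero_add,
    qMultichoose_succ_mul_qInt hq, mul_assoc (qInt q r)]
  rw [← Finset.mul_sum, sum_antidiagonal_inv_pow_qMultichoose h0, upperSum_succ]
  have h1 := qMultichoose_succ_mul_qInt hq (N + 1) A
  have h2 := hq A
  have h3 := hq N
  have e3 : qMultichoose q (N + 1) (A + 1) / qInt q (N + 1) =
      qMultichoose q (N + 2) A / qInt q (A + 1) := by
    rw [div_eq_div_iff h3 h2, h1, mul_comm]
  have e4 : q ^ (A + 1 + (N + 1)) * (q ^ ((A + 1 + 1) * (N + 1)))⁻¹ = (q ^ ((A + 1) * N))⁻¹ := by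
    rw [show (A + 1 + 1) * (N + 1) = (A + 1) * N + (A + 1 + (N + 1)) by ring, pow_add q ((A + 1) * N), mul_inv]
    have := pow_ne_zero (A + 1 + (N + 1)) h0
    field_simp
  rw [show r + 1 + (A + 1) = r + (A + 1) + 1 by ring, ← e3]
  linear_combination (-(qMultichoose q (r + (A + 1) + 1) N * qMultichoose q (N + 1) (A + 1) *
    qInt q r / qInt q (N + 1))) * e4

theorem upperSum_eq_qBinomial (hq : ∀ n, qInt q (n + 1) ≠ 0) (r A B : ℕ) :
    upperSum q r A (B + 1) = (q ^ ((A + 1) * (B + 1)))⁻¹ * qBinomial q (r + A + B) (r + A) *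
      qBinomial q (A + (B + 1)) A * (qInt q r / qInt q (A + (B + 1))) := by
  rw [upperSum_succ, qMultichoose_eq_qBinomial hq]
  have h1 : qMultichoose q (B + 1) A / qInt q (B + 1) =
      qBinomial q (A + (B + 1)) A / qInt q (A + (B + 1)) := by
    rw [← qMultichoose_eq_qBinomial hq, qMultichoose_succ_eq_div hq, qMultichoose_succ_eq_div hq,
      ← add_assoc, qFactorial_succ, qFactorial_succ, add_comm B A]
    have h1 := hq (A + B)
    have h2 := hq B
    have h3 := qFactorial_ne_zero hq A
    have h4 := qFactorial_ne_zero hq B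
    field_simp
  linear_combination ((q ^ ((A + 1) * (B + 1)))⁻¹ * qBinomial q (r + A + B) (r + A) *
    qInt q r) * h1

end QAlgebra

/-- As a polynomial, [n+1] takes the value 1 at 0. -/
theorem qInt_ratFuncX_ne_zero (n : ℕ) : qInt (RatFunc.X : RatFunc ℚ) (n + 1) ≠ 0 := by
  have h : qInt (RatFunc.X : RatFunc ℚ) (n + 1) = algebraMap (Polynomial ℚ) (RatFunc ℚ)
      (∑ i ∈ Finset.range (n + 1), Polynomial.X ^ i) := by
    simp [qInt, RatFunc.algebraMap_X]
  rw [h]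
  refine RatFunc.algebraMap_ne_zero fun h0 => ?_
  have := congrArg (Polynomial.eval 0) h0
  simp [Polynomial.eval_finsetSum, Finset.sum_range_succ'] at this

/-- A car without its label: its diagonal, and whether it is big. -/
abbrev Letter := ℕ × Bool

/-! ### Chains of letters and their main diagonals -/

namespace Letter

/-- `x.Step y`: a car of kind `y` may occupy the row above a car of kind `x`. -/
def Step (x y : Letter) : Prop :=
  y.1 ≤ x.1 ∨ (y.1 = x.1 + 1 ∧ x.2 = false ∧ y.2 = true)

instance : DecidableRel Step := fun _ _ => inferInstanceAs (Decidable (_ ∨ _))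

/-- The number of diagonal inversions formed by a car and a car in a higher row. -/
def pairInv (x y : Letter) : ℕ :=
  (if x.1 = y.1 ∧ x.2 = false ∧ y.2 = true then 1 else 0) +
    if x.1 = y.1 + 1 ∧ x.2 = true ∧ y.2 = false then 1 else 0

theorem step_raise (x y : Letter) : Step (x.1 + 1, x.2) (y.1 + 1, y.2) ↔ Step x y := by
  simp [Step]

theorem step_zero (x : Letter) (t : Bool) : Step x (0, t) := by simp [Step]

theorem step_zero_raise (t : Bool) (y : Letter) :
    Step (0, t) (y.1 + 1, y.2) ↔ t = false ∧ y = (0, true) := by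
  rcases y with ⟨k, b⟩
  simp [Step]
  tauto

end Letter

open Letter

/-- The kinds of the cars in the main diagonal. -/
def lowWord : List Letter → List Bool
  | [] => []
  | (0, t) :: L => t :: lowWord L
  | (_ + 1, _) :: L => lowWord L

/-- The cars above the main diagonal, moved down by one diagonal. -/
def highPart : List Letter → List Letter
  | [] => []
  | (0, _) :: L => highPart L
  | (k + 1, t) :: L => (k, t) :: highPart L

/-- The number of small cars. -/
def smallCount (L : List Letter) : ℕ := (L.map Prod.snd).count false

/-- The number of big cars. -/
def bigCount (L : List Letter) : ℕ := (L.map Prod.snd).count true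

/-- The number of diagonal inversions. -/
def listDinv : List Letter → ℕ
  | [] => 0
  | x :: L => (L.map (pairInv x)).sum + listDinv L

/-- The sum of the diagonals of the cars. -/
def listArea (L : List Letter) : ℕ := (L.map Prod.fst).sum

/-- The number of pairs of a small letter and a later big letter. -/
def wordInv : List Bool → ℕ
  | [] => 0
  | t :: w => (if t then 0 else w.count true) + wordInv w

/-- The number of diagonal inversions between the main diagonal and the next one. -/
def crossInv : List Letter → ℕ
  | [] => 0
  | x :: L => (if x = (1, true) then (lowWord L).count false else 0) + crossInv L

theorem sum_map_pairInv_zero (t : Bool) (L : List Letter) :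
    (L.map (pairInv (0, t))).sum = if t then 0 else (lowWord L).count true := by
  induction L with
  | nil => simp [lowWord]
  | cons x L ih =>
    rcases x with ⟨_ | k, b⟩ <;> cases t <;> cases b <;> simp_all [lowWord, pairInv, add_comm]

theorem sum_map_pairInv_succ (k : ℕ) (t : Bool) (L : List Letter) :
    (L.map (pairInv (k + 1, t))).sum = ((highPart L).map (pairInv (k, t))).sum +
      if (k + 1, t) = (1, true) then (lowWord L).count false else 0 := by
  induction L with
  | nil => simp [lowWord, highPart]
  | cons x L ih =>
    rcases x with ⟨_ | j, b⟩ <;> cases t <;> cases b <;> rcases k with _ | k <;>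
      simp_all [lowWord, highPart, pairInv, add_comm, add_left_comm, add_assoc]
    simp only [eq_comm]

/-- Pairs are sorted by whether both cars, neither, or just one lies in the main diagonal. A mixed
pair counts only if a big car of diagonal 1 precedes a small main-diagonal car. -/
theorem listDinv_eq (L : List Letter) :
    listDinv L = wordInv (lowWord L) + listDinv (highPart L) + crossInv L := by
  induction L with
  | nil => rfl
  | cons x L ih =>
    rcases x with ⟨_ | k, t⟩
    · simp only [listDinv, lowWord, highPart, crossInv, wordInv, sum_map_pairInv_zero, ih]
      simp
      ring
    · simp only [listDinv, lowWord, highPart, crossInv, sum_map_pairInv_succ, ih]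
      ring

theorem listArea_eq (L : List Letter) :
    listArea L = listArea (highPart L) + (highPart L).length := by
  induction L with
  | nil => rfl
  | cons x L ih =>
    simp only [listArea] at ih ⊢
    rcases x with ⟨_ | k, t⟩ <;> simp [highPart, ih]
    ring

theorem length_eq_low_add_high (L : List Letter) :
    L.length = (lowWord L).length + (highPart L).length := by
  induction L with
  | nil => rfl
  | cons x L ih => rcases x with ⟨_ | k, t⟩ <;> simp [highPart, lowWord, ih] <;> ring

theorem length_eq_small_add_big (L : List Letter) : L.length = smallCount L + bigCount L := by
  rw [smallCount, bigCount, List.count_false_add_count_true, List.length_map]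

theorem smallCount_eq (L : List Letter) :
    smallCount L = (lowWord L).count false + smallCount (highPart L) := by
  induction L with
  | nil => rfl
  | cons x L ih =>
    simp only [smallCount] at ih ⊢
    rcases x with ⟨_ | k, _ | _⟩ <;> simp [highPart, lowWord, ih] <;> ring

theorem bigCount_eq (L : List Letter) :
    bigCount L = (lowWord L).count true + bigCount (highPart L) := by
  induction L with
  | nil => rfl
  | cons x L ih =>
    simp only [bigCount] at ih ⊢
    rcases x with ⟨_ | k, _ | _⟩ <;> simp [highPart, lowWord, ih] <;> ring

theorem count_lowWord (t : Bool) (L : List Letter) : (lowWord L).count t = L.count (0, t) := by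
  induction L with
  | nil => rfl
  | cons x L ih => rcases x with ⟨_ | k, _ | _⟩ <;> cases t <;> simp [lowWord, ih]

/-- The list is empty or starts with a big car in the main diagonal. -/
def StartsBig (M : List Letter) : Prop := ∀ m ∈ M.head?, m = (0, true)

instance : DecidablePred StartsBig := fun M =>
  decidable_of_iff (M = [] ∨ M.head? = some (0, true)) <| by
    cases M <;> simp [StartsBig]

theorem startsBig_nil : StartsBig [] := by simp [StartsBig]

theorem startsBig_cons {m : Letter} {M : List Letter} : StartsBig (m :: M) ↔ m = (0, true) := by
  simp [StartsBig]

/-- Deleting a run of main-diagonal cars is harmless: the next car above them is big and in diagonal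
1, so it is lowered to `(0, true)`, which may follow any letter. The two parts distinguish a
preceding car above or in the main diagonal. -/
theorem isChain_highPart (L : List Letter) :
    (∀ k t, ((k + 1, t) :: L).IsChain Step → ((k, t) :: highPart L).IsChain Step) ∧
    ∀ t, ((0, t) :: L).IsChain Step → (highPart L).IsChain Step ∧ StartsBig (highPart L) := by
  induction L with
  | nil => simp [highPart, startsBig_nil]
  | cons x L ih =>
    rcases x with ⟨_ | j, b⟩
    · refine ⟨fun k t h => ?_, fun t h => ?_⟩
      · obtain ⟨h1, h2⟩ := ih.2 b (List.isChain_cons_cons.1 h).2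
        rw [highPart]
        revert h1 h2
        generalize highPart L = M
        cases M with
        | nil => simp
        | cons m M =>
          intro h1 h2
          rw [startsBig_cons] at h2
          subst h2
          exact List.isChain_cons_cons.2 ⟨step_zero _ _, h1⟩
      · exact ih.2 b (List.isChain_cons_cons.1 h).2
    · refine ⟨fun k t h => ?_, fun t h => ?_⟩
      · rw [List.isChain_cons_cons] at h
        exact List.isChain_cons_cons.2 ⟨(step_raise (k, t) (j, b)).1 h.1, ih.1 _ _ h.2⟩
      · rw [List.isChain_cons_cons] at h
        exact ⟨ih.1 _ _ h.2, startsBig_cons.2 ((step_zero_raise t (j, b)).1 h.1).2⟩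

/-- The lists with given main diagonal and given part above it that may follow the letter `p`. -/
def lifts : Letter → List Bool → List Letter → Finset (List Letter)
  | _, [], [] => {[]}
  | _, x :: w, [] => (lifts (0, x) w []).image (List.cons (0, x))
  | p, [], m :: M =>
    if Step p (m.1 + 1, m.2) then
      (lifts (m.1 + 1, m.2) [] M).image (List.cons (m.1 + 1, m.2)) else ∅
  | p, x :: w, m :: M =>
    (lifts (0, x) w (m :: M)).image (List.cons (0, x)) ∪
      if Step p (m.1 + 1, m.2) then
        (lifts (m.1 + 1, m.2) (x :: w) M).image (List.cons (m.1 + 1, m.2)) else ∅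
  termination_by _ w M => w.length + M.length

theorem mem_lifts (p : Letter) (w : List Bool) (M L : List Letter) :
    L ∈ lifts p w M ↔ (p :: L).IsChain Step ∧ lowWord L = w ∧ highPart L = M := by
  induction L generalizing p w M with
  | nil =>
    rcases w with _ | ⟨x, w⟩ <;> rcases M with _ | ⟨m, M⟩ <;> simp [lifts, lowWord, highPart]
    · split_ifs <;> simp
    · split_ifs <;> simp
  | cons y L ih =>
    rcases y with ⟨_ | k, t⟩ <;> rcases w with _ | ⟨x, w⟩ <;> rcases M with _ | ⟨m, M⟩ <;>
      simp only [lifts, lowWord, highPart, List.isChain_cons_cons]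
    · simp
    · split_ifs <;> simp
    · simp [ih, step_zero]
      grind
    · split_ifs <;> simp [ih, step_zero] <;> grind
    · simp
    · split_ifs <;> simp [ih] <;> grind
    · simp
    · split_ifs <;> simp [ih] <;> grind

/-- The words with `r` small and `s` big letters. -/
def words : ℕ → ℕ → Finset (List Bool)
  | 0, 0 => {[]}
  | r + 1, 0 => (words r 0).image (List.cons false)
  | 0, s + 1 => (words 0 s).image (List.cons true)
  | r + 1, s + 1 =>
    (words r (s + 1)).image (List.cons false) ∪ (words (r + 1) s).image (List.cons true)

theorem mem_words (r s : ℕ) (w : List Bool) :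
    w ∈ words r s ↔ w.count false = r ∧ w.count true = s := by
  induction w generalizing r s with
  | nil => rcases r with _ | r <;> rcases s with _ | s <;> simp [words]
  | cons t w ih =>
    rcases r with _ | r <;> rcases s with _ | s <;> cases t <;> simp [words, ih]

/-- The words with `r` small and `s` big letters that are empty or start with a big letter. -/
def bigWords : ℕ → ℕ → Finset (List Bool)
  | 0, 0 => {[]}
  | _ + 1, 0 => ∅
  | r, s + 1 => (words r s).image (List.cons true)

theorem mem_bigWords (r s : ℕ) (w : List Bool) :
    w ∈ bigWords r s ↔ w.count false = r ∧ w.count true = s ∧ ∀ t ∈ w.head?, t = true := by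
  rcases w with _ | ⟨_ | _, w⟩ <;> rcases r with _ | r <;> rcases s with _ | s <;>
    simp [bigWords, mem_words]

/-- The lists of length `n` that may follow the letter `p`. -/
def chains : Letter → ℕ → Finset (List Letter)
  | _, 0 => {[]}
  | p, n + 1 => ((Finset.range (p.1 + 2) ×ˢ Finset.univ).filter (Step p)).biUnion fun x =>
      (chains x n).image (List.cons x)

theorem mem_chains (p : Letter) (n : ℕ) (L : List Letter) :
    L ∈ chains p n ↔ L.length = n ∧ (p :: L).IsChain Step := by
  induction L generalizing p n with
  | nil => rcases n with _ | n <;> simp [chains]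
  | cons x L ih =>
    rcases n with _ | n
    · simp [chains]
    · simp only [chains, Finset.mem_biUnion, Finset.mem_filter, Finset.mem_product,
        Finset.mem_range, Finset.mem_univ, and_true, Finset.mem_image, List.cons.injEq,
        List.length_cons, Nat.add_right_cancel_iff, List.isChain_cons_cons]
      constructor
      · rintro ⟨y, ⟨-, h⟩, L', h1, rfl, rfl⟩
        rw [ih] at h1
        exact ⟨h1.1, h, h1.2⟩
      · rintro ⟨h1, h2, h3⟩
        refine ⟨x, ⟨?_, h2⟩, L, (ih _ _).2 ⟨h1, h3⟩, rfl, rfl⟩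
        rcases h2 with h2 | h2 <;> omega

/-- The admissible lists with given main diagonal and given numbers of cars above it. -/
def listsOver (w : List Bool) (A B : ℕ) : Finset (List Letter) :=
  (chains (0, true) (w.length + A + B)).filter fun L =>
    lowWord L = w ∧ smallCount (highPart L) = A ∧ bigCount (highPart L) = B

theorem mem_listsOver {w : List Bool} {A B : ℕ} {L : List Letter} :
    L ∈ listsOver w A B ↔ ((0, true) :: L).IsChain Step ∧ lowWord L = w ∧
      smallCount (highPart L) = A ∧ bigCount (highPart L) = B := by
  rw [listsOver, Finset.mem_filter, mem_chains]
  refine ⟨fun h => ⟨h.1.2, h.2⟩, fun h => ⟨⟨?_, h.1⟩, h.2⟩⟩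
  rw [length_eq_low_add_high, length_eq_small_add_big (highPart L), h.2.1, h.2.2.1, h.2.2.2,
    add_assoc]

/-- The admissible lists of `A` small and `B` big cars that are empty or start with a big car. -/
def bigLists (A B : ℕ) : Finset (List Letter) :=
  (chains (0, true) (A + B)).filter fun L => StartsBig L ∧ smallCount L = A ∧ bigCount L = B

theorem mem_bigLists {A B : ℕ} {L : List Letter} :
    L ∈ bigLists A B ↔ ((0, true) :: L).IsChain Step ∧ StartsBig L ∧
      smallCount L = A ∧ bigCount L = B := by
  rw [bigLists, Finset.mem_filter, mem_chains]
  refine ⟨fun h => ⟨h.1.2, h.2⟩, fun h => ⟨⟨?_, h.1⟩, h.2⟩⟩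
  rw [length_eq_small_add_big L, h.2.2.1, h.2.2.2]

/-- The sentinel `(0, true)` stands for the condition u_1 = 0: no rise can follow a big car, so the
first letter of the list lies in the main diagonal and is the first letter of `lowWord`. -/
theorem startsBig_iff {L : List Letter} (h : ((0, true) :: L).IsChain Step) :
    StartsBig L ↔ ∀ t ∈ (lowWord L).head?, t = true := by
  rcases L with _ | ⟨⟨_ | k, t⟩, L⟩
  · simp [StartsBig, lowWord]
  · simp [StartsBig, lowWord]
  · simp [Step] at h

/-! ### Generating functions of chains of letters -/

section Sums

variable {K : Type*} [Field K] (q : K)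

theorem qMultichoose_one (i : ℕ) : qMultichoose q 1 i = 1 := by
  induction i with
  | zero => simp
  | succ i ih => rw [qMultichoose_succ_succ q 0 i, ih]; simp

theorem sum_words (r s : ℕ) :
    ∑ w ∈ words r s, q ^ wordInv w = qMultichoose q (s + 1) r := by
  have hinj (t : Bool) : Function.Injective (List.cons t) := List.cons_injective
  induction s generalizing r with
  | zero =>
    induction r with
    | zero => simp [words, wordInv]
    | succ r ih =>
      rw [words, Finset.sum_image (hinj _).injOn, zero_add, qMultichoose_one]
      rw [zero_add, qMultichoose_one] at ih
      rw [← ih]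
      refine Finset.sum_congr rfl fun w hw => ?_
      simp [wordInv, ((mem_words _ _ _).1 hw).2]
  | succ s ihs =>
    induction r with
    | zero =>
      rw [words, Finset.sum_image (hinj _).injOn]
      simpa [wordInv] using ihs 0
    | succ r ih =>
      rw [words, Finset.sum_union, Finset.sum_image (hinj _).injOn, Finset.sum_image (hinj _).injOn,
        qMultichoose_succ_succ, ← ih, ← ihs (r + 1), add_comm, Finset.mul_sum]
      · congr 1
        · simp [wordInv]
        · refine Finset.sum_congr rfl fun w hw => ?_
          rw [wordInv, ((mem_words _ _ _).1 hw).2, pow_add]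
          simp
      · rw [Finset.disjoint_left]
        intro w h1 h2
        simp only [Finset.mem_image] at h1 h2
        obtain ⟨_, -, rfl⟩ := h1
        obtain ⟨_, -, h⟩ := h2
        simp at h

/-- A leading big letter has nothing before it and forms no inversion, so one variable fewer than in
`sum_words` remains. -/
theorem sum_bigWords (r s : ℕ) :
    ∑ w ∈ bigWords r s, q ^ wordInv w = qMultichoose q s r := by
  rcases s with _ | s
  · rcases r with _ | r <;> simp [bigWords, wordInv]
  · rw [bigWords, Finset.sum_image (List.cons_injective).injOn, ← sum_words]
    simp [wordInv]

theorem sum_image_cons_zero (p : Letter) (x : Bool) (w : List Bool) (M : List Letter) :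
    ∑ L ∈ (lifts p w M).image (List.cons (0, x)), q ^ crossInv L =
      ∑ L ∈ lifts p w M, q ^ crossInv L := by
  rw [Finset.sum_image (List.cons_injective).injOn]
  simp [crossInv]

theorem sum_image_cons_succ (p m : Letter) (w : List Bool) (M : List Letter) :
    ∑ L ∈ (lifts p w M).image (List.cons (m.1 + 1, m.2)), q ^ crossInv L =
      q ^ (if m = (0, true) then w.count false else 0) * ∑ L ∈ lifts p w M, q ^ crossInv L := by
  rw [Finset.sum_image (List.cons_injective).injOn, Finset.mul_sum]
  refine Finset.sum_congr rfl fun L hL => ?_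
  rw [crossInv, ((mem_lifts _ _ _ _).1 hL).2.1, pow_add]
  simp [Prod.ext_iff]

theorem sum_lifts_nil_cons (p m : Letter) (M : List Letter) :
    ∑ L ∈ lifts p [] (m :: M), q ^ crossInv L =
      if Step p (m.1 + 1, m.2) then
        ∑ L ∈ lifts (m.1 + 1, m.2) [] M, q ^ crossInv L else 0 := by
  rw [lifts]
  split_ifs
  · rw [sum_image_cons_succ]; simp
  · simp

theorem sum_lifts_cons_cons (p m : Letter) (x : Bool) (w : List Bool) (M : List Letter) :
    ∑ L ∈ lifts p (x :: w) (m :: M), q ^ crossInv L =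
      ∑ L ∈ lifts (0, x) w (m :: M), q ^ crossInv L +
      if Step p (m.1 + 1, m.2) then q ^ (if m = (0, true) then (x :: w).count false else 0) *
        ∑ L ∈ lifts (m.1 + 1, m.2) (x :: w) M, q ^ crossInv L else 0 := by
  rw [lifts]
  split_ifs with h1 h2
  · rw [Finset.sum_union, sum_image_cons_zero, sum_image_cons_succ, if_pos h2]
    rw [Finset.disjoint_left]
    intro w h1 h2
    simp only [Finset.mem_image] at h1 h2
    obtain ⟨_, -, rfl⟩ := h1
    obtain ⟨_, -, h⟩ := h2
    simp at h
  · rw [Finset.sum_union, sum_image_cons_zero, sum_image_cons_succ, if_neg h2]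
    rw [Finset.disjoint_left]
    intro w h1 h2
    simp only [Finset.mem_image] at h1 h2
    obtain ⟨_, -, rfl⟩ := h1
    obtain ⟨_, -, h⟩ := h2
    simp at h
  · rw [Finset.union_empty, sum_image_cons_zero, add_zero]

theorem sum_lifts_nil (p : Letter) (w : List Bool) :
    ∑ L ∈ lifts p w [], q ^ crossInv L = 1 := by
  induction w generalizing p with
  | nil => simp [lifts, crossInv]
  | cons x w ih => rw [lifts, sum_image_cons_zero, ih]

/-- Each `(0, true)` in `M` records how many small main-diagonal cars come after it. These numbers
decrease weakly along `M` and determine the lift. With r small letters in `w` they range over 0, …,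
r, where r means that none has been passed; the value r is excluded directly after a big
main-diagonal car, on which nothing can sit. -/
theorem sum_lifts (M : List Letter) : ∀ w : List Bool,
    (∀ k t, ((k, t) :: M).IsChain Step → ∑ L ∈ lifts (k + 1, t) w M, q ^ crossInv L =
      qMultichoose q (w.count false + 1) (M.count (0, true))) ∧
    (M.IsChain Step → ∀ t, ∑ L ∈ lifts (0, t) w M, q ^ crossInv L =
      if StartsBig M then
        qMultichoose q (w.count false + if t then 0 else 1) (M.count (0, true)) else 0) := by
  induction M with
  | nil => intro w; simp [sum_lifts_nil, startsBig_nil]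
  | cons m M ihM =>
    intro w
    have hc (m : Letter) (M : List Letter) : (m :: M).count (0, true) =
        M.count (0, true) + if m = (0, true) then 1 else 0 := by
      simp [List.count_cons]
    induction w with
    | nil =>
      refine ⟨fun k t h => ?_, fun h t => ?_⟩
      · rw [List.isChain_cons_cons] at h
        rw [sum_lifts_nil_cons, if_pos ((step_raise (k, t) m).2 h.1), (ihM []).1 _ _ h.2]
        simp [qMultichoose_one]
      · rw [sum_lifts_nil_cons, (ihM []).1 _ _ h]
        simp only [step_zero_raise, startsBig_cons, hc]
        by_cases hm : m = (0, true) <;> cases t <;> simp [hm, qMultichoose_one]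
    | cons x w ihw =>
      have hx : (x :: w).count false = w.count false + if x then 0 else 1 := by
        cases x <;> simp
      refine ⟨fun k t h => ?_, fun h t => ?_⟩
      · rw [List.isChain_cons_cons] at h
        rw [sum_lifts_cons_cons, if_pos ((step_raise (k, t) m).2 h.1), (ihM _).1 _ _ h.2,
          ihw.2 h.2 x, ← hx, hc]
        simp only [startsBig_cons]
        -- If `m` is `(0, true)`, the Pascal rule is the choice between placing `x` first and
        -- placing `m` first, the latter with weight q^r for r small letters in `x :: w`. Otherwise
        -- `m` must come first.
        by_cases hm : m = (0, true)
        · simp [hm, qMultichoose_succ_succ]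
        · simp [hm]
      · rw [sum_lifts_cons_cons, (ihM _).1 _ _ h, ihw.2 h x, ← hx, hc]
        simp only [step_zero_raise, startsBig_cons]
        by_cases hm : m = (0, true)
        · cases t <;> simp [hm, qMultichoose_succ_succ]
        · simp [hm]

/-- The weight of a list of cars. -/
def listWeight (L : List Letter) : K := q ^ ((listDinv L : ℤ) - (listArea L : ℤ))

variable {q}

theorem sum_lifts_listWeight (h0 : q ≠ 0) (w : List Bool) {M : List Letter}
    (hM : M.IsChain Step) (hb : StartsBig M) :
    ∑ L ∈ lifts (0, true) w M, listWeight q L = q ^ wordInv w * (q ^ M.length)⁻¹ *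
      (qMultichoose q (w.count false) (M.count (0, true)) * listWeight q M) := by
  have h := (sum_lifts q M w).2 hM true
  rw [if_pos hb, if_pos rfl, add_zero] at h
  rw [← h, Finset.sum_mul, Finset.mul_sum]
  refine Finset.sum_congr rfl fun L hL => ?_
  obtain ⟨-, h1, h2⟩ := (mem_lifts _ _ _ _).1 hL
  rw [listWeight, listWeight, listDinv_eq, listArea_eq, h1, h2, ← zpow_natCast, ← zpow_natCast,
    ← zpow_natCast, ← zpow_neg, ← zpow_add₀ h0, ← zpow_add₀ h0, ← zpow_add₀ h0]
  congr 1
  push_cast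
  ring

/-- The sum is fibred over `highPart`; each fibre is a set of lifts after the sentinel. -/
theorem sum_listsOver_eq (h0 : q ≠ 0) (w : List Bool) (A B : ℕ) :
    ∑ L ∈ listsOver w A B, listWeight q L = q ^ wordInv w * (q ^ (A + B))⁻¹ *
      ∑ M ∈ bigLists A B,
        qMultichoose q (w.count false) (M.count (0, true)) * listWeight q M := by
  have hmap : ∀ L ∈ listsOver w A B, highPart L ∈ bigLists A B := by
    intro L hL
    obtain ⟨h1, -, h2, h3⟩ := mem_listsOver.1 hL
    obtain ⟨h4, h5⟩ := (isChain_highPart L).2 _ h1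
    refine mem_bigLists.2 ⟨?_, h5, h2, h3⟩
    revert h4 h5
    generalize highPart L = M
    cases M with
    | nil => simp
    | cons m M =>
      intro h4 h5
      rw [startsBig_cons] at h5
      exact List.isChain_cons_cons.2 ⟨by rw [h5]; exact step_zero _ _, h4⟩
  rw [← Finset.sum_fiberwise_of_maps_to hmap, Finset.mul_sum]
  refine Finset.sum_congr rfl fun M hM => ?_
  obtain ⟨h1, h2, h3, h4⟩ := mem_bigLists.1 hM
  rw [← h3, ← h4, ← length_eq_small_add_big, ← sum_lifts_listWeight h0 w (M := M) h1.tail h2]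
  refine Finset.sum_congr (Finset.ext fun L => ?_) fun _ _ => rfl
  rw [Finset.mem_filter, mem_listsOver, mem_lifts]
  grind

theorem sum_bigLists_eq (f : ℕ → K) (A B : ℕ) :
    ∑ M ∈ bigLists A B, f (M.count (0, true)) * listWeight q M =
      ∑ x ∈ Finset.HasAntidiagonal.antidiagonal B, ∑ y ∈ Finset.HasAntidiagonal.antidiagonal A,
        f x.1 * ∑ w ∈ bigWords y.1 x.1, ∑ M ∈ listsOver w y.2 x.2, listWeight q M := by
  have hmap : ∀ M ∈ bigLists A B,
      (((lowWord M).count true, bigCount (highPart M)),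
        ((lowWord M).count false, smallCount (highPart M))) ∈
      Finset.HasAntidiagonal.antidiagonal B ×ˢ Finset.HasAntidiagonal.antidiagonal A := by
    intro M hM
    obtain ⟨-, -, h3, h4⟩ := mem_bigLists.1 hM
    simp only [Finset.mem_product, Finset.HasAntidiagonal.mem_antidiagonal]
    rw [← smallCount_eq, ← bigCount_eq]
    exact ⟨h4, h3⟩
  rw [← Finset.sum_fiberwise_of_maps_to hmap, Finset.sum_product]
  refine Finset.sum_congr rfl fun x hx => Finset.sum_congr rfl fun y hy => ?_
  rw [Finset.HasAntidiagonal.mem_antidiagonal] at hx hy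
  have hmap' : ∀ M ∈ (bigLists A B).filter fun M => (((lowWord M).count true, bigCount (highPart M)),
        ((lowWord M).count false, smallCount (highPart M))) = (x, y),
      lowWord M ∈ bigWords y.1 x.1 := by
    intro M hM
    obtain ⟨hM, h⟩ := Finset.mem_filter.1 hM
    obtain ⟨h1, h2, -, -⟩ := mem_bigLists.1 hM
    rw [Prod.ext_iff] at h
    exact (mem_bigWords _ _ _).2
      ⟨congrArg Prod.fst h.2, congrArg Prod.fst h.1, (startsBig_iff h1).1 h2⟩
  rw [← Finset.sum_fiberwise_of_maps_to hmap', Finset.mul_sum]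
  refine Finset.sum_congr rfl fun w hw => ?_
  rw [Finset.mul_sum]
  obtain ⟨hw1, hw2, hw3⟩ := (mem_bigWords _ _ _).1 hw
  refine Finset.sum_congr (Finset.ext fun M => ?_) fun M hM => ?_
  · rw [Finset.mem_filter, Finset.mem_filter, mem_bigLists, mem_listsOver, smallCount_eq M,
      bigCount_eq M, Prod.ext_iff, Prod.ext_iff, Prod.ext_iff]
    constructor
    · rintro ⟨⟨⟨h1, -⟩, ⟨-, h2⟩, -, h3⟩, h4⟩
      exact ⟨h1, h4, h3, h2⟩
    · rintro ⟨h1, rfl, h3, h4⟩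
      refine ⟨⟨⟨h1, (startsBig_iff h1).2 hw3, ?_, ?_⟩, ⟨hw2, h4⟩, hw1, h3⟩, rfl⟩
      · rw [hw1, h3, hy]
      · rw [hw2, h4, hx]
  · rw [← count_lowWord, (mem_listsOver.1 hM).2.1, hw2]

theorem listsOver_nil {A B : ℕ} (h : 0 < A + B) : listsOver [] A B = ∅ := by
  refine Finset.eq_empty_of_forall_notMem fun L hL => ?_
  obtain ⟨h1, h2, h3, h4⟩ := mem_listsOver.1 hL
  rcases L with _ | ⟨⟨_ | k, t⟩, L⟩
  · simp [highPart, smallCount, bigCount] at h3 h4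
    omega
  · simp [lowWord] at h2
  · simp [Step] at h1

/-- Strong induction on the number of cars above the main diagonal: peeling a nonempty diagonal off
the high part lowers that number, and `sum_upperSum` closes the recursion. -/
theorem sum_listsOver (h0 : q ≠ 0) (hq : ∀ n, qInt q (n + 1) ≠ 0) (w : List Bool) (A B : ℕ) :
    ∑ L ∈ listsOver w A B, listWeight q L =
      q ^ wordInv w * upperSum q (w.count false) A B := by
  induction hN : A + B using Nat.strong_induction_on generalizing w A B with
  | _ N ih =>
    rw [sum_listsOver_eq h0]
    rcases Nat.eq_zero_or_pos N with h | hpos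
    · obtain ⟨rfl, rfl⟩ : A = 0 ∧ B = 0 := by omega
      have : bigLists 0 0 = {[]} := by
        ext L
        rw [Finset.mem_singleton, mem_bigLists]
        refine ⟨fun h => List.length_eq_zero_iff.1 ?_, ?_⟩
        · rw [length_eq_small_add_big, h.2.2.1, h.2.2.2]
        · rintro rfl
          simp [startsBig_nil, smallCount, bigCount]
      simp [this, listWeight, listDinv, listArea, upperSum_zero_zero]
    · rw [sum_bigLists_eq]
      have key : ∀ x ∈ Finset.HasAntidiagonal.antidiagonal B,
          ∀ y ∈ Finset.HasAntidiagonal.antidiagonal A,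
          ∑ w ∈ bigWords y.1 x.1, ∑ M ∈ listsOver w y.2 x.2, listWeight q M =
          qMultichoose q x.1 y.1 * upperSum q y.1 y.2 x.2 := by
        rintro ⟨s, B'⟩ hx ⟨r, A'⟩ hy
        rw [Finset.HasAntidiagonal.mem_antidiagonal] at hx hy
        simp only at hx hy ⊢
        rw [← sum_bigWords, Finset.sum_mul]
        refine Finset.sum_congr rfl fun v hv => ?_
        obtain ⟨h1, h2, -⟩ := (mem_bigWords _ _ _).1 hv
        -- An empty next diagonal does not lower the number of cars, so the induction hypothesis is
        -- unavailable; both sides are zero there.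
        rcases Nat.eq_zero_or_pos (r + s) with h | h
        · obtain ⟨rfl, rfl⟩ : r = 0 ∧ s = 0 := by omega
          obtain rfl : v = [] := by simpa [bigWords] using hv
          rw [listsOver_nil (by omega), upperSum_zero_left _ (by omega)]
          simp
        · rw [ih (A' + B') (by omega) v A' B' rfl, h1]
      rw [Finset.sum_congr rfl fun x hx => Finset.sum_congr rfl fun y hy => by rw [key x hx y hy],
        sum_upperSum h0 hq _ _ _ (by omega), mul_assoc]
      congr 1
      rw [← mul_assoc, inv_mul_cancel₀ (pow_ne_zero _ h0), one_mul]

/-- The admissible lists with given numbers of cars in the main diagonal and above it. -/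
def admissibleLists (r s A B : ℕ) : Finset (List Letter) :=
  (chains (0, true) (r + s + A + B)).filter fun L =>
    ((lowWord L).count false = r ∧ (lowWord L).count true = s) ∧
      smallCount (highPart L) = A ∧ bigCount (highPart L) = B

theorem mem_admissibleLists {r s A B : ℕ} {L : List Letter} :
    L ∈ admissibleLists r s A B ↔ ((0, true) :: L).IsChain Step ∧
      ((lowWord L).count false = r ∧ (lowWord L).count true = s) ∧
      smallCount (highPart L) = A ∧ bigCount (highPart L) = B := by
  rw [admissibleLists, Finset.mem_filter, mem_chains]
  refine ⟨fun h => ⟨h.1.2, h.2⟩, fun h => ⟨⟨?_, h.1⟩, h.2⟩⟩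
  rw [length_eq_small_add_big, smallCount_eq, bigCount_eq, h.2.1.1, h.2.1.2, h.2.2.1, h.2.2.2]
  ring

theorem sum_admissibleLists (h0 : q ≠ 0) (hq : ∀ n, qInt q (n + 1) ≠ 0) (r s A B : ℕ) :
    ∑ L ∈ admissibleLists r s A B, listWeight q L =
      qMultichoose q (s + 1) r * upperSum q r A B := by
  have hmap : ∀ L ∈ admissibleLists r s A B, lowWord L ∈ words r s := fun L hL =>
    (mem_words _ _ _).2 (mem_admissibleLists.1 hL).2.1
  rw [← Finset.sum_fiberwise_of_maps_to hmap, ← sum_words, Finset.sum_mul]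
  refine Finset.sum_congr rfl fun w hw => ?_
  have hw' := (mem_words _ _ _).1 hw
  nth_rewrite 2 [← hw'.1]
  rw [← sum_listsOver h0 hq]
  refine Finset.sum_congr (Finset.ext fun L => ?_) fun _ _ => rfl
  rw [Finset.mem_filter, mem_listsOver, mem_admissibleLists]
  grind

end Sums

/-! ### Permutations, lists of function values and shuffles -/

theorem card_filter_perm_lt {n : ℕ} (σ : Equiv.Perm (Fin n)) (i : Fin n) :
    (Finset.univ.filter fun j => σ j < σ i).card = σ i := by
  rw [← Fin.card_Iio (σ i)]
  exact Finset.card_equiv σ fun j => by simp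

theorem perm_eq_of_lt_iff_lt {n : ℕ} {σ τ : Equiv.Perm (Fin n)}
    (h : ∀ i j, σ i < σ j ↔ τ i < τ j) : σ = τ := by
  ext i
  rw [← card_filter_perm_lt σ, ← card_filter_perm_lt τ]
  simp only [h]

theorem listArea_ofFn {n : ℕ} (f : Fin n → Letter) :
    listArea (List.ofFn f) = ∑ i, (f i).1 := by
  rw [listArea, List.map_ofFn, List.sum_ofFn]
  rfl

theorem listDinv_ofFn {n : ℕ} (f : Fin n → Letter) :
    listDinv (List.ofFn f) = ∑ i, ∑ j, if i < j then pairInv (f i) (f j) else 0 := by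
  induction n with
  | zero => simp [listDinv]
  | succ n ih =>
    rw [List.ofFn_succ, listDinv, ih, List.map_ofFn, List.sum_ofFn, Fin.sum_univ_succ]
    congr 1
    · rw [Fin.sum_univ_succ]
      simp
    · refine Finset.sum_congr rfl fun i _ => ?_
      rw [Fin.sum_univ_succ]
      simp

theorem count_ofFn {α : Type*} [BEq α] [LawfulBEq α] [DecidableEq α] {n : ℕ} (f : Fin n → α) (x : α) :
    (List.ofFn f).count x = (Finset.univ.filter fun i => f i = x).card := by
  rw [Finset.card_filter]
  induction n with
  | zero => simp
  | succ n ih =>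
    rw [List.ofFn_succ, List.count_cons, ih, Fin.sum_univ_succ, add_comm]
    simp

theorem isChain_cons_ofFn {n : ℕ} (p : Letter) (f : Fin n → Letter) :
    (p :: List.ofFn f).IsChain Step ↔ (∀ i : Fin n, (i : ℕ) = 0 → Step p (f i)) ∧
      ∀ i j : Fin n, (j : ℕ) = (i : ℕ) + 1 → Step (f i) (f j) := by
  have h : (List.ofFn f).IsChain Step ↔
      ∀ i j : Fin n, (j : ℕ) = (i : ℕ) + 1 → Step (f i) (f j) := by
    rw [List.isChain_ofFn]
    constructor
    · rintro h ⟨i, hi⟩ ⟨j, hj⟩ rfl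
      exact h i hj
    · exact fun h i hi => h _ _ rfl
  rw [← h]
  cases n with
  | zero => simp
  | succ n =>
    rw [List.ofFn_succ, List.isChain_cons_cons]
    refine and_congr_left fun _ => ⟨fun h i hi => ?_, fun h => h 0 rfl⟩
    obtain rfl : i = 0 := Fin.ext hi
    exact h

theorem isShuffle_filter {α : Type*} (p : α → Prop) [DecidablePred p] (w : List α) :
    IsShuffle (w.filter fun c => p c) (w.filter fun c => ¬ p c) w := by
  induction w with
  | nil => exact IsShuffle.nil
  | cons c w ih =>
    by_cases h : p c
    · simpa [List.filter_cons, h] using IsShuffle.left c ih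
    · simpa [List.filter_cons, h] using IsShuffle.right c ih

theorem isShuffle_iff_filter {α : Type*} (p : α → Prop) [DecidablePred p] {x y w : List α}
    (hx : ∀ c ∈ x, p c) (hy : ∀ c ∈ y, ¬ p c) :
    IsShuffle x y w ↔ (w.filter fun c => p c) = x ∧ (w.filter fun c => ¬ p c) = y := by
  constructor
  · intro h
    induction h with
    | nil => simp
    | left c _ ih =>
      have := ih (fun d hd => hx d (List.mem_cons_of_mem _ hd)) hy
      have hc := hx c List.mem_cons_self
      simp_all
    | right c _ ih =>
      have := ih hx (fun d hd => hy d (List.mem_cons_of_mem _ hd))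
      have hc := hy c List.mem_cons_self
      simp_all
  · rintro ⟨rfl, rfl⟩
    exact isShuffle_filter p w

theorem eq_range'_iff_pairwise {l : List ℕ} {s n : ℕ} (hl : l.Nodup)
    (hmem : ∀ c, c ∈ l ↔ s ≤ c ∧ c < s + n) : l = List.range' s n ↔ l.Pairwise (· < ·) := by
  constructor
  · rintro rfl
    exact List.pairwise_lt_range'
  · intro h
    refine List.Perm.eq_of_pairwise' (r := (· < ·)) h List.pairwise_lt_range' ?_
    rw [List.perm_ext_iff_of_nodup hl List.nodup_range']
    intro c
    rw [hmem, List.mem_range'_1]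

/-- Replaces positions in the reading word by the explicit relation `Before` on rows. -/
theorem pairwise_iff_of_pairwise {α : Type*} {r R : α → α → Prop} {l : List α}
    (hr : ∀ i j, r i j → ¬ r j i) (hl : l.Pairwise r) (hmem : ∀ i, i ∈ l) :
    l.Pairwise R ↔ ∀ i j, r i j → R i j := by
  refine ⟨fun h i j hij => ?_, fun h => hl.imp fun hij => h _ _ hij⟩
  obtain ⟨x, hx, rfl⟩ := List.getElem_of_mem (hmem i)
  obtain ⟨y, hy, rfl⟩ := List.getElem_of_mem (hmem j)
  rw [List.pairwise_iff_getElem] at h hl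
  rcases lt_trichotomy x y with hxy | rfl | hxy
  · exact h _ _ hx hy hxy
  · exact absurd hij (hr _ _ hij)
  · exact absurd hij (hr _ _ (hl _ _ hy hx hxy))

/-! ### The correspondence between parking functions and chains of letters -/

namespace ParkingFunction

variable {n : ℕ}

/-- The car in row `i` precedes the car in row `j` in the reading word. -/
def Before (u : Fin n → ℕ) (i j : Fin n) : Prop := u j < u i ∨ (u i = u j ∧ j < i)

theorem Before.asymm {u : Fin n → ℕ} (i j : Fin n) : Before u i j → ¬ Before u j i := by
  unfold Before
  omega

theorem before_trichotomy (u : Fin n → ℕ) (i j : Fin n) :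
    Before u i j ∨ i = j ∨ Before u j i := by
  unfold Before
  omega

/-- The rows in the order of the reading word. -/
def readingOrder (P : ParkingFunction n) : List (Fin n) :=
  (List.range n).reverse.flatMap fun d => (List.finRange n).reverse.filter fun i => P.u i = d

theorem readingWord_eq (P : ParkingFunction n) : P.readingWord = P.readingOrder.map P.car := by
  rw [readingWord, readingOrder, List.map_flatMap]

theorem mem_readingOrder (P : ParkingFunction n) (i : Fin n) : i ∈ P.readingOrder := by
  simp only [readingOrder, List.mem_flatMap, List.mem_reverse, List.mem_range, List.mem_filter,
    List.mem_finRange, true_and, decide_eq_true_eq]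
  exact ⟨P.u i, (P.u_le i).trans_lt i.isLt, rfl⟩

theorem pairwise_readingOrder (P : ParkingFunction n) : P.readingOrder.Pairwise (Before P.u) := by
  rw [readingOrder, List.pairwise_flatMap]
  constructor
  · intro d _
    rw [List.pairwise_filter, List.pairwise_reverse]
    refine (List.pairwise_lt_finRange n).imp fun hij hj hi => ?_
    simp only [decide_eq_true_eq] at hi hj
    exact Or.inr ⟨hj.trans hi.symm, hij⟩
  · rw [List.pairwise_reverse]
    refine List.pairwise_lt_range.imp fun hde i hi j hj => ?_
    simp only [List.mem_filter, decide_eq_true_eq] at hi hj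
    exact Or.inl (by omega)

theorem car_injective (P : ParkingFunction n) : Function.Injective P.car := fun _ _ h =>
  P.v.injective (Fin.ext (Nat.succ_injective h))

theorem mem_readingWord (P : ParkingFunction n) (c : ℕ) :
    c ∈ P.readingWord ↔ 1 ≤ c ∧ c ≤ n := by
  rw [readingWord_eq, List.mem_map]
  constructor
  · rintro ⟨i, -, rfl⟩
    exact ⟨Nat.succ_pos _, (P.v i).isLt⟩
  · rintro ⟨h1, h2⟩
    refine ⟨P.v.symm ⟨c - 1, by omega⟩, P.mem_readingOrder _, ?_⟩
    simp [car, h1]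

theorem nodup_readingWord (P : ParkingFunction n) : P.readingWord.Nodup := by
  rw [readingWord_eq]
  refine List.Nodup.map P.car_injective ?_
  exact P.pairwise_readingOrder.imp fun hij => by
    rintro rfl
    exact Before.asymm _ _ hij hij

/-- The small cars, and likewise the big cars, are increasing along the reading word. -/
def IncreasingByKind (a : ℕ) (P : ParkingFunction n) : Prop :=
  ∀ i j, Before P.u i j → (a < P.car i ↔ a < P.car j) → P.v i < P.v j

/-- The reading word contains every car once, so its small and big subwords are the prescribed ones
as soon as they increase. -/
theorem isShuffle_readingWord_iff {a b : ℕ} (P : ParkingFunction (a + b)) :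
    IsShuffle (List.range' 1 a) (List.range' (a + 1) b) P.readingWord ↔ P.IncreasingByKind a := by
  rw [isShuffle_iff_filter (fun c => c ≤ a), eq_range'_iff_pairwise, eq_range'_iff_pairwise,
    readingWord_eq, List.pairwise_filter, List.pairwise_filter, List.pairwise_map,
    List.pairwise_map, pairwise_iff_of_pairwise Before.asymm P.pairwise_readingOrder
      P.mem_readingOrder, pairwise_iff_of_pairwise Before.asymm P.pairwise_readingOrder
      P.mem_readingOrder]
  · have hv (i j) : P.v i < P.v j ↔ P.car i < P.car j := by simp [car]
    simp only [IncreasingByKind, hv, decide_eq_true_eq]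
    constructor
    · rintro ⟨h1, h2⟩ i j hij h
      rcases le_or_gt (P.car i) a with hi | hi
      · exact h1 i j hij hi (not_lt.1 (h.not.1 (not_lt.2 hi)))
      · exact h2 i j hij (not_le.2 hi) (not_le.2 (h.1 hi))
    · exact fun h => ⟨fun i j hij hi hj => h i j hij (by omega),
        fun i j hij hi hj => h i j hij (by omega)⟩
  · exact P.nodup_readingWord.filter _
  · intro c
    simp only [List.mem_filter, mem_readingWord, decide_eq_true_eq]
    omega
  · exact P.nodup_readingWord.filter _
  · intro c
    simp only [List.mem_filter, mem_readingWord, decide_eq_true_eq]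
    omega
  · intro c hc
    rw [List.mem_range'_1] at hc
    omega
  · intro c hc
    rw [List.mem_range'_1] at hc
    omega

/-- The diagonal and the kind of the car in row `i`. -/
def letter (a : ℕ) (P : ParkingFunction n) (i : Fin n) : Letter := (P.u i, decide (a < P.car i))

/-- `Before` is total on distinct rows, so the order of the cars is lexicographic: kind first, then
reading order. Hence the letters determine the permutation. -/
theorem IncreasingByKind.lt_iff {a : ℕ} {P : ParkingFunction n} (h : P.IncreasingByKind a)
    (i j : Fin n) : P.v i < P.v j ↔
      ((P.letter a i).2 < (P.letter a j).2 ∨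
        ((P.letter a i).2 = (P.letter a j).2 ∧ Before P.u i j)) := by
  have hlt : P.v i < P.v j ↔ P.car i < P.car j := by simp [car]
  have hgt : P.v j < P.v i ↔ P.car j < P.car i := by simp [car]
  have hij := h i j
  have hji := h j i
  simp only [letter, Bool.lt_iff, decide_eq_decide, decide_eq_false_iff_not, decide_eq_true_eq]
  rcases before_trichotomy P.u i j with hb | rfl | hb
  · have := hij hb
    by_cases h1 : a < P.car i <;> by_cases h2 : a < P.car j <;> simp_all <;> omega
  · have := Before.asymm (u := P.u) i i
    simp_all
  · have := hji hb
    have := Before.asymm (u := P.u) j i hb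
    by_cases h1 : a < P.car i <;> by_cases h2 : a < P.car j <;> simp_all <;> omega

theorem letter_injOn {a : ℕ} {P Q : ParkingFunction n} (hP : P.IncreasingByKind a)
    (hQ : Q.IncreasingByKind a) (h : P.letter a = Q.letter a) : P = Q := by
  have hu : P.u = Q.u := funext fun i => congrArg Prod.fst (congrFun h i)
  refine ParkingFunction.ext hu (perm_eq_of_lt_iff_lt fun i j => ?_)
  rw [hP.lt_iff, hQ.lt_iff, h, hu]

/-- At a rise the upper car is read first but is the larger one, so the two kinds differ. -/
theorem isChain_letter {a : ℕ} {P : ParkingFunction n} (hP : P.IncreasingByKind a) :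
    ((0, true) :: List.ofFn (P.letter a)).IsChain Step := by
  rw [isChain_cons_ofFn]
  refine ⟨fun i hi => Or.inl (P.u_first i hi).le, fun i j hij => ?_⟩
  rcases (P.u_step i j hij).lt_or_eq with h | h
  · exact Or.inl (Nat.lt_succ_iff.1 h)
  · refine Or.inr ⟨h, ?_⟩
    have hb : Before P.u j i := Or.inl (by omega)
    rcases (hP.lt_iff i j).1 (P.v_column i j hij h) with h1 | h1
    · rwa [Bool.lt_iff] at h1
    · exact absurd h1.2 (Before.asymm _ _ hb)

theorem listArea_letter (a : ℕ) (P : ParkingFunction n) :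
    listArea (List.ofFn (P.letter a)) = P.area := listArea_ofFn _

theorem listDinv_letter {a : ℕ} {P : ParkingFunction n} (hP : P.IncreasingByKind a) :
    listDinv (List.ofFn (P.letter a)) = P.dinv := by
  rw [listDinv_ofFn, dinv, Finset.card_filter, Finset.card_filter, ← Finset.sum_add_distrib,
    Fintype.sum_prod_type]
  refine Finset.sum_congr rfl fun i _ => Finset.sum_congr rfl fun j _ => ?_
  by_cases hij : i < j
  · have h1 := hP i j
    have h2 := hP j i
    have hlt : P.v i < P.v j ↔ P.car i < P.car j := by simp [car]
    have hgt : P.v j < P.v i ↔ P.car j < P.car i := by simp [car]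
    rw [if_pos hij, pairInv]
    congr 1
    · refine if_congr ?_ rfl rfl
      simp only [letter, decide_eq_false_iff_not, decide_eq_true_eq, Before] at *
      constructor
      · rintro ⟨h3, h4, h5⟩
        exact ⟨hij, h3, by omega⟩
      · rintro ⟨-, h3, h4⟩
        have := h2 (Or.inr ⟨h3.symm, hij⟩)
        by_cases h5 : a < P.car i <;> by_cases h6 : a < P.car j <;> simp_all <;> omega
    · refine if_congr ?_ rfl rfl
      simp only [letter, decide_eq_false_iff_not, decide_eq_true_eq, Before] at *
      constructor
      · rintro ⟨h3, h4, h5⟩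
        exact ⟨hij, h3, by omega⟩
      · rintro ⟨-, h3, h4⟩
        have := h1 (Or.inl (by omega))
        by_cases h5 : a < P.car i <;> by_cases h6 : a < P.car j <;> simp_all <;> omega
  · simp [hij]

theorem listWeight_letter {K : Type*} [Field K] {q : K} (h0 : q ≠ 0) {a : ℕ}
    {P : ParkingFunction n} (hP : P.IncreasingByKind a) :
    q ^ (P.coarea + (P.dinv : ℤ)) =
      q ^ (n.choose 2 : ℤ) * listWeight q (List.ofFn (P.letter a)) := by
  rw [listWeight, listDinv_letter hP, listArea_letter, coarea, ← zpow_add₀ h0]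
  congr 1
  ring

theorem card_small {a b : ℕ} (σ : Equiv.Perm (Fin (a + b))) :
    (Finset.univ.filter fun i => ¬ a < (σ i : ℕ) + 1).card = a := by
  have : (Finset.univ.filter fun i => ¬ a < (σ i : ℕ) + 1).card =
      (Finset.univ.filter fun i : Fin (a + b) => (i : ℕ) < a).card :=
    Finset.card_equiv σ fun j => by simp
  rw [this, Fin.card_filter_val_lt]
  omega

theorem smallCount_letter {a b : ℕ} (P : ParkingFunction (a + b)) :
    smallCount (List.ofFn (P.letter a)) = a := by
  rw [smallCount, List.map_ofFn, count_ofFn]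
  simpa [letter, car] using card_small P.v

theorem bigCount_letter {a b : ℕ} (P : ParkingFunction (a + b)) :
    bigCount (List.ofFn (P.letter a)) = b := by
  have h := length_eq_small_add_big (List.ofFn (P.letter a))
  rw [smallCount_letter, List.length_ofFn] at h
  omega

/-- The totals a and b force the counts above the main diagonal; for a member of `shufflePF` the
subtractions do not truncate. -/
theorem mem_shufflePF_iff {a b r s : ℕ} (P : ParkingFunction (a + b)) :
    P ∈ shufflePF a b r s ↔ P.IncreasingByKind a ∧
      List.ofFn (P.letter a) ∈ admissibleLists r s (a - r) (b - s) := by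
  have h1 := smallCount_eq (List.ofFn (P.letter a))
  have h2 := bigCount_eq (List.ofFn (P.letter a))
  rw [smallCount_letter] at h1
  rw [bigCount_letter] at h2
  rw [mem_admissibleLists]
  simp only [count_lowWord, count_ofFn] at h1 h2 ⊢
  simp only [letter, Prod.mk.injEq, decide_eq_false_iff_not, decide_eq_true_eq, not_lt] at h1 h2 ⊢
  simp only [shufflePF, Finset.mem_filter, Finset.mem_univ, true_and, isShuffle_readingWord_iff]
  constructor
  · rintro ⟨h3, h4, h5⟩
    exact ⟨h3, isChain_letter h3, ⟨h4, h5⟩, by omega, by omega⟩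
  · rintro ⟨h3, -, h4, -⟩
    exact ⟨h3, h4⟩

theorem exists_perm_lt_iff {β : Type*} [LinearOrder β] (f : Fin n → β)
    (hf : Function.Injective f) : ∃ σ : Equiv.Perm (Fin n), ∀ i j, σ i < σ j ↔ f i < f j := by
  refine ⟨(Tuple.sort f)⁻¹, fun i j => ?_⟩
  have h : StrictMono (f ∘ Tuple.sort f) :=
    (Tuple.monotone_sort f).strictMono_of_injective (hf.comp (Tuple.sort f).injective)
  rw [← h.lt_iff_lt]
  simp

theorem exists_letter_eq {a b : ℕ} (f : Fin (a + b) → Letter)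
    (hc : ((0, true) :: List.ofFn f).IsChain Step) (ha : smallCount (List.ofFn f) = a) :
    ∃ P : ParkingFunction (a + b), P.IncreasingByKind a ∧ P.letter a = f := by
  rw [isChain_cons_ofFn] at hc
  -- The key sorts by kind, then by decreasing diagonal, then by decreasing row, as
  -- `IncreasingByKind.lt_iff` dictates. The row makes it injective.
  obtain ⟨σ, hσ⟩ := exists_perm_lt_iff
    (fun i => toLex ((f i).2, toLex (OrderDual.toDual (f i).1, OrderDual.toDual i)))
    (fun i j h => by simpa using (congrArg (fun x => (ofLex (ofLex x).2).2) h))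
  have hσ' (i j) : σ i < σ j ↔ ((f i).2 < (f j).2 ∨
      ((f i).2 = (f j).2 ∧ Before (fun i => (f i).1) i j)) := by
    rw [hσ, Prod.Lex.toLex_lt_toLex, Prod.Lex.toLex_lt_toLex]
    rfl
  have hcard : (Finset.univ.filter fun i => (f i).2 = false).card = a := by
    rw [smallCount, List.map_ofFn, count_ofFn] at ha
    exact ha
  -- `σ i` counts the rows with smaller key: fewer than a for a small letter, at least a for a big
  -- one.
  have hkind (i) : a < (σ i : ℕ) + 1 ↔ (f i).2 = true := by
    rw [← card_filter_perm_lt σ i, Nat.lt_succ_iff]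
    constructor
    · intro h
      by_contra hi
      rw [Bool.not_eq_true] at hi
      refine absurd (Finset.card_lt_card (s := Finset.univ.filter fun j => σ j < σ i)
        (t := Finset.univ.filter fun j => (f j).2 = false) ?_) (by omega)
      rw [Finset.ssubset_iff_of_subset]
      · exact ⟨i, by simpa using hi, by simp⟩
      · intro j hj
        simp only [Finset.mem_filter, Finset.mem_univ, true_and, hσ', hi, Bool.lt_iff] at hj ⊢
        simp_all
    · intro hi
      refine hcard.ge.trans (Finset.card_le_card fun j hj => ?_)
      simp only [Finset.mem_filter, Finset.mem_univ, true_and] at hj ⊢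
      exact (hσ' j i).2 (Or.inl (by simp [hi, hj]))
  refine ⟨⟨fun i => (f i).1, σ, fun i hi => ?_, fun i j hij => ?_, fun i j hij h => ?_⟩, ?_, ?_⟩
  · have := hc.1 i hi
    simp [Step] at this
    exact this
  · rcases hc.2 i j hij with h | h <;> omega
  · rcases hc.2 i j hij with h' | h'
    · omega
    · exact (hσ' i j).2 (Or.inl (by simp [h'.2.1, h'.2.2]))
  · intro i j hij h
    refine (hσ' i j).2 (Or.inr ⟨?_, hij⟩)
    rw [Bool.eq_iff_iff, ← hkind, ← hkind]
    exact h
  · funext i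
    refine Prod.ext rfl ?_
    rw [Bool.eq_iff_iff, ← hkind]
    simp [letter, car]

theorem sum_shufflePF {K : Type*} [Field K] {q : K} (h0 : q ≠ 0)
    (hq : ∀ n, qInt q (n + 1) ≠ 0) {a b r s : ℕ} (hr : r ≤ a) (hs : s ≤ b) :
    ∑ P ∈ shufflePF a b r s, q ^ (P.coarea + (P.dinv : ℤ)) =
      q ^ ((a + b).choose 2 : ℤ) * (qMultichoose q (s + 1) r * upperSum q r (a - r) (b - s)) := by
  rw [← sum_admissibleLists h0 hq, Finset.mul_sum]
  refine Finset.sum_bij (fun P _ => List.ofFn (P.letter a)) ?_ ?_ ?_ ?_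
  · exact fun P hP => ((mem_shufflePF_iff P).1 hP).2
  · intro P hP Q hQ h
    exact letter_injOn ((mem_shufflePF_iff P).1 hP).1 ((mem_shufflePF_iff Q).1 hQ).1
      (List.ofFn_injective h)
  · intro L hL
    obtain ⟨h1, ⟨h2, h3⟩, h4, h5⟩ := mem_admissibleLists.1 hL
    have ha : smallCount L = a := by rw [smallCount_eq, h2, h4]; omega
    have hb : bigCount L = b := by rw [bigCount_eq, h3, h5]; omega
    have hlen : L.length = a + b := by rw [length_eq_small_add_big, ha, hb]
    obtain ⟨f, rfl⟩ : ∃ f : Fin (a + b) → Letter, List.ofFn f = L :=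
      ⟨fun i => L[i], List.ext_getElem (by simp [hlen]) (by simp)⟩
    obtain ⟨P, hP, rfl⟩ := exists_letter_eq f h1 ha
    exact ⟨P, (mem_shufflePF_iff P).2 ⟨hP, hL⟩, rfl⟩
  · exact fun P hP => listWeight_letter h0 ((mem_shufflePF_iff P).1 hP).1

end ParkingFunction

theorem theorem1p1 (q : RatFunc ℚ) (hq : q = RatFunc.X) (a b : ℕ) :
    (∀ r s : ℕ, r ≤ a → s < b →
      ∑ P ∈ shufflePF a b r s, q ^ (P.coarea + (P.dinv : ℤ)) =
        q ^ (((a + b).choose 2 : ℤ) - ((a : ℤ) - (r : ℤ) + 1) * ((b : ℤ) - (s : ℤ))) *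
          qBinomial q (a + b - s - 1) a *
          qBinomial q ((a - r) + (b - s)) (a - r) *
          qBinomial q (r + s) s *
          (qInt q r / qInt q ((a - r) + (b - s)))) ∧
    (∀ r : ℕ, r ≤ a →
      ∑ P ∈ shufflePF a b r b, q ^ (P.coarea + (P.dinv : ℤ)) =
        if a = r then q ^ ((a + b).choose 2) * qBinomial q (a + b) a else 0) := by
  have h0 : q ≠ 0 := hq ▸ RatFunc.X_ne_zero
  have hq' : ∀ n, qInt q (n + 1) ≠ 0 := hq ▸ qInt_ratFuncX_ne_zero
  clear hq
  refine ⟨fun r s hr hs => ?_, fun r hr => ?_⟩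
  · obtain ⟨A, rfl⟩ := Nat.exists_eq_add_of_le hr
    obtain ⟨B, rfl⟩ := Nat.exists_eq_add_of_lt hs
    rw [ParkingFunction.sum_shufflePF h0 hq' hr hs.le, qMultichoose_eq_qBinomial hq',
      Nat.add_sub_cancel_left, show s + B + 1 - s = B + 1 by omega, upperSum_eq_qBinomial hq',
      show r + A + (s + B + 1) - s - 1 = r + A + B by omega, add_comm s r, zpow_sub₀ h0,
      show ((r + A : ℕ) : ℤ) - r + 1 = ((A + 1 : ℕ) : ℤ) by push_cast; ring,
      show ((s + B + 1 : ℕ) : ℤ) - s = ((B + 1 : ℕ) : ℤ) by push_cast; ring, ← Nat.cast_mul,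
      zpow_natCast, zpow_natCast, div_eq_mul_inv (q ^ _)]
    ring
  · rw [ParkingFunction.sum_shufflePF h0 hq' hr le_rfl, Nat.sub_self, zpow_natCast]
    split_ifs with h
    · subst h
      rw [Nat.sub_self, upperSum_zero_zero, mul_one, qMultichoose_eq_qBinomial hq',
        qBinomial_symm_add, add_comm b a]
    -- Here r < a: small cars would lie above the main diagonal without any big car there.
    · rw [show a - r = a - r - 1 + 1 by omega, upperSum_succ_zero, mul_zero, mul_zero]
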